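/- Let $\mathcal M$ be a $C^*$-algebra and let $X=(X(n))_{n\ge 0}$ be a standard subproduct system of $C^*$-correspondences over $\mathcal M$: each $X(n)$ is a right Hilbert $\mathcal M$-module with a nondegenerate left action of $\mathcal M$ by adjointable operators, $X(0)=\mathcal M$, and each $X(n+m)$ is (via an associative family of isometric adjointable bimodule embeddings) an orthogonally complemented sub-bimodule of $X(n)\otimes X(m)$. Let $U_{n,m}:X(n)\otimes X(m)\to X(n+m)$ be the corresponding coisometric projections, where $U_{n,0}$ and $U_{0,n}$ are the right and left actions of $\mathcal M$. (Alternatively, everything may be taken in the $W^*$-setting: $\mathcal M$ is a $W^*$-algebra, the $X(n)$ are self-dual with normal left action, tensor products of correspondences are self-dual extensions, and the representation $\pi$ below is normal.) Let $\pi:\mathcal M\to B(\mathcal E)$ be a representation on a Hilbert space $\mathcal E$. Let $\mathcal F_X=\bigoplus_{n\ge0}X(n)$ be the Fock space, so that $\mathcal F_X\otimes_\pi\mathcal E=\bigoplus_{n\ge 0}X(n)\otimes_\pi\mathcal E$, and for $\zeta\in X(n)$ let $S_n(\zeta)\otimes I_{\mathcal E}$ be the bounded operator on $\mathcal F_X\otimes_\pi\mathcal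 E$ with $(S_n(\zeta)\otimes I_{\mathcal E})(\eta\otimes e)=U_{n,m}(\zeta\otimes\eta)\otimes e$ for $\eta\in X(m)$, $e\in\mathcal E$. Let $T=(T_n)_{n\ge0}$ be a covariant representation of $X$ on a Hilbert space $\mathcal H$: the maps $T_n:X(n)\to B(\mathcal H)$ are linear, $\sigma:=T_0$ is a $*$-representation of $\mathcal M$, $T_n(a\zeta b)=\sigma(a)T_n(\zeta)\sigma(b)$, and $T_{n+m}(U_{n,m}(\zeta\otimes\eta))=T_n(\zeta)T_m(\eta)$. ($T$ need not be pure, nor completely contractive.) For a subspace $\mathcal V\subseteq\mathcal H$ put $\mathfrak L_n(\mathcal V,T)=\overline{\mathrm{span}}\{T_n(\zeta)v:\zeta\in X(n),\,v\in\mathcal V\}$ and $\mathfrak L(\mathcal V)=\mathfrak L_1(\mathcal V,T)$. The subspace $\mathcal V$ is called $T$-invariant if $T_n(\zeta)\mathcal V\subseteq\mathcal V$ for all $n\ge0$ and $\zeta\in X(n)$. A closed subspace $\mathcal V$ is called wandering for $T$ if it is $\sigma(\mathcal M)$-invariant and $\mathcal V\perp\mathfrak L_n(\mathcal V,T)$ for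 every $n\ge1$. Let $\Pi:\mathcal F_X\otimes_\pi\mathcal E\to\mathcal H$ be a partial isometry such that $$\Pi\,(S_n(\zeta)\otimes I_{\mathcal E})=T_n(\zeta)\,\Pi\qquad(n\ge0,\ \zeta\in X(n)).$$ Then $\mathcal S:=\mathrm{ran}\,\Pi$ is a closed $T$-invariant subspace of $\mathcal H$; the subspace $\mathcal W:=\mathcal S\ominus\mathfrak L(\mathcal S)$ is a wandering subspace for $T|_{\mathcal S}=(T_n(\cdot)|_{\mathcal S})_{n\ge0}$; and $$\mathcal W=\Pi\big((\ker\Pi)^\perp\cap(\mathcal M\otimes_\pi\mathcal E)\big),$$ where $\mathcal M\otimes_\pi\mathcal E=X(0)\otimes_\pi\mathcal E$ is the degree-zero summand of $\mathcal F_X\otimes_\pi\mathcal E$. -/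

import Mathlib

open scoped TensorProduct ComplexOrder InnerProductSpace

universe u v w z

set_option linter.unusedSectionVars false

namespace Subproduct

/-! ## Hilbert modules and correspondences -/

/-- A (complete) right Hilbert `C*`-module over `M`, with inner product linear in the second
variable: `⟨x, y a⟩ = ⟨x, y⟩ a`.  (Mathlib's `CStarModule M E` satisfies `⟨x, a y⟩ = a ⟨x, y⟩`,
i.e. it describes *left* modules.) -/
class HilbertModule (M : Type u) (E : Type v) [NonUnitalCStarAlgebra M] [PartialOrder M]
    [NormedAddCommGroup E] [NormedSpace ℂ E] [CompleteSpace E] where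
  /-- the `M`-valued inner product -/
  ip : E → E → M
  /-- the right action `x ↦ x a` -/
  rmul : E →ₗ[ℂ] M →ₗ[ℂ] E
  rmul_mul : ∀ x a b, rmul x (a * b) = rmul (rmul x a) b
  ip_add_right : ∀ x y z, ip x (y + z) = ip x y + ip x z
  ip_smul_right : ∀ (c : ℂ) x y, ip x (c • y) = c • ip x y
  ip_rmul : ∀ x y a, ip x (rmul y a) = ip x y * a
  star_ip : ∀ x y, star (ip x y) = ip y x
  ip_self_nonneg : ∀ x, 0 ≤ ip x x
  norm_sq : ∀ x, ‖x‖ ^ 2 = ‖ip x x‖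

/-- A `C*`-correspondence over `M`: a Hilbert `M`-module with a nondegenerate left action of `M`
by adjointable operators. -/
class Correspondence (M : Type u) (E : Type v) [NonUnitalCStarAlgebra M] [PartialOrder M]
    [NormedAddCommGroup E] [NormedSpace ℂ E] [CompleteSpace E] extends HilbertModule M E where
  /-- the left action `x ↦ a x` -/
  lmul : M →ₗ[ℂ] E →ₗ[ℂ] E
  lmul_mul : ∀ a b x, lmul (a * b) x = lmul a (lmul b x)
  ip_lmul : ∀ a x y, ip (lmul a x) y = ip x (lmul (star a) y)
  lmul_rmul : ∀ a x b, lmul a (rmul x b) = rmul (lmul a x) b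
  lmul_nondegenerate :
    Dense (Submodule.span ℂ {y : E | ∃ a x, y = lmul a x} : Set E)

section Basic

variable {M : Type u} [NonUnitalCStarAlgebra M] [PartialOrder M]

/-- The `M`-valued inner product of a Hilbert module. -/
abbrev ip (M : Type u) {E : Type v} [NonUnitalCStarAlgebra M] [PartialOrder M]
    [NormedAddCommGroup E] [NormedSpace ℂ E] [CompleteSpace E] [HilbertModule M E]
    (x y : E) : M := HilbertModule.ip x y

/-- The right action of `M`. -/
abbrev rmul {E : Type v} [NormedAddCommGroup E] [NormedSpace ℂ E] [CompleteSpace E]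
    [HilbertModule M E] (x : E) (a : M) : E := HilbertModule.rmul x a

/-- The left action of `M`. -/
abbrev lmul {E : Type v} [NormedAddCommGroup E] [NormedSpace ℂ E] [CompleteSpace E]
    [Correspondence M E] (a : M) (x : E) : E := Correspondence.lmul a x

end Basic

/-! ## Positivity of Gram matrices -/

section Gram

variable {M : Type u} [NonUnitalCStarAlgebra M] [PartialOrder M]

/-- An `M`-valued semi-inner product on a complex space with a right `M`-action. -/
structure IsSemiInner {E : Type v} [AddCommGroup E] (r : E → M → E) (s : E → E → M) : Prop where
  add_right : ∀ x y z, s x (y + z) = s x y + s x z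
  act_right : ∀ x y a, s x (r y a) = s x y * a
  star_swap : ∀ x y, star (s x y) = s y x
  self_nonneg : ∀ x, 0 ≤ s x x

theorem IsSemiInner.sum_right {E : Type v} [AddCommGroup E] {r : E → M → E} {s : E → E → M}
    (hs : IsSemiInner r s) {ι : Type*} (t : Finset ι) (x : E) (y : ι → E) :
    s x (∑ i ∈ t, y i) = ∑ i ∈ t, s x (y i) := by
  let f : E →+ M := AddMonoidHom.mk' (s x) (hs.add_right x)
  exact map_sum f y t

theorem IsSemiInner.sum_left {E : Type v} [AddCommGroup E] {r : E → M → E} {s : E → E → M}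
    (hs : IsSemiInner r s) {ι : Type*} (t : Finset ι) (x : E) (y : ι → E) :
    s (∑ i ∈ t, y i) x = ∑ i ∈ t, s (y i) x := by
  rw [← hs.star_swap, hs.sum_right, star_sum]
  simp [hs.star_swap]

theorem IsSemiInner.act_left {E : Type v} [AddCommGroup E] {r : E → M → E} {s : E → E → M}
    (hs : IsSemiInner r s) (x y : E) (a : M) : s (r x a) y = star a * s x y := by
  rw [← hs.star_swap, hs.act_right, star_mul, hs.star_swap]

variable [StarOrderedRing M]

theorem eq_zero_of_sum_star_mul_self {ι : Type*} (t : Finset ι) (b : ι → M)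
    (h : ∑ i ∈ t, star (b i) * b i ≤ 0) : ∀ i ∈ t, b i = 0 := by
  intro i hi
  have h0 : ∀ j ∈ t, 0 ≤ star (b j) * b j := fun j _ => star_mul_self_nonneg _
  have h1 : star (b i) * b i ≤ 0 := (Finset.single_le_sum h0 hi).trans h
  have h2 : star (b i) * b i = 0 := le_antisymm h1 (h0 i hi)
  simpa using h2

theorem exists_posPart_negPart {N : Type*} [NonUnitalCStarAlgebra N] [PartialOrder N]
    [StarOrderedRing N] (g : N) (hg : IsSelfAdjoint g) :
    ∃ p c : N, 0 ≤ p ∧ 0 ≤ c ∧ g = p - c ∧ c * p = 0 :=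
  ⟨g⁺, g⁻, CFC.posPart_nonneg g, CFC.negPart_nonneg g, (CFC.posPart_sub_negPart g hg).symm,
    CFC.negPart_mul_posPart g⟩

theorem exists_eq_star_mul_self {N : Type*} [NonUnitalCStarAlgebra N] [PartialOrder N]
    [StarOrderedRing N] {g : N} (hg : 0 ≤ g) : ∃ b : N, g = star b * b :=
  (CStarAlgebra.nonneg_iff_eq_star_mul_self).1 hg

/-- A Gram matrix of an `M`-valued semi-inner product is of the form `B* B`. -/
theorem IsSemiInner.exists_gram {E : Type v} [AddCommGroup E] {r : E → M → E} {s : E → E → M}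
    (hs : IsSemiInner r s) {n : ℕ} (x : Fin n → E) :
    ∃ B : Fin n → Fin n → M, ∀ i j, s (x i) (x j) = ∑ k, star (B k i) * B k j := by
  classical
  let G : CStarMatrix (Fin n) (Fin n) M := CStarMatrix.ofMatrix (fun i j => s (x i) (x j))
  have hGapp : ∀ i j, G i j = s (x i) (x j) := fun i j => rfl
  have hG : IsSelfAdjoint G := by
    ext i j
    rw [CStarMatrix.star_apply, hGapp, hGapp, hs.star_swap]
  obtain ⟨P, C, hP, hC, hGPC, hCP⟩ := exists_posPart_negPart G hG
  have hCsa : star C = C := IsSelfAdjoint.of_nonneg hC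
  have hCGC : star C * G * C = -(C * C * C) := by
    rw [hCsa, hGPC, mul_sub, hCP, zero_sub, neg_mul]
  have hC3 : 0 ≤ C * C * C := by
    have := star_left_conjugate_nonneg hC C
    rwa [hCsa] at this
  obtain ⟨D, hD⟩ := exists_eq_star_mul_self hC3
  have hmul : ∀ (B : CStarMatrix (Fin n) (Fin n) M) i j,
      (star B * B) i j = ∑ k, star (B k i) * B k j := by
    intro B i j
    rw [CStarMatrix.mul_apply]; rfl
  have hdiag : ∀ l, ∑ k, star (D k l) * D k l ≤ 0 := by
    intro l
    have e2 : (star C * G * C) l l =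
        s (∑ i, r (x i) (C i l)) (∑ i, r (x i) (C i l)) := by
      rw [hs.sum_right, CStarMatrix.mul_apply]
      refine Finset.sum_congr rfl fun j _ => ?_
      rw [hs.act_right, hs.sum_left, CStarMatrix.mul_apply]
      congr 1
      refine Finset.sum_congr rfl fun i _ => ?_
      rw [hs.act_left, CStarMatrix.star_apply, hGapp]
    have e3 : (star C * G * C) l l = - ∑ k, star (D k l) * D k l := by
      rw [hCGC, hD, ← hmul]; rfl
    have := hs.self_nonneg (∑ i, r (x i) (C i l))
    rw [← e2, e3] at this
    simpa using this
  have hD0 : D = 0 := by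
    ext k l
    exact eq_zero_of_sum_star_mul_self _ _ (hdiag l) k (Finset.mem_univ k)
  have hC0 : C = 0 := by
    have h3 : C * C * C = 0 := by rw [hD, hD0]; simp
    have h4 : star (C * C) * (C * C) = 0 := by
      rw [star_mul, hCsa, ← mul_assoc, h3, zero_mul]
    have h5 : C * C = 0 := (CStarRing.star_mul_self_eq_zero_iff _).1 h4
    have h6 : star C * C = 0 := by rw [hCsa, h5]
    simpa using h6
  have hGpos : 0 ≤ G := by
    rw [hGPC, hC0, sub_zero]; exact hP
  obtain ⟨B, hB⟩ := exists_eq_star_mul_self hGpos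
  refine ⟨fun k i => B k i, fun i j => ?_⟩
  rw [← hGapp, hB, hmul]

end Gram

/-! ## Consequences for Hilbert modules -/

section HilbertModule

variable {M : Type u} [NonUnitalCStarAlgebra M] [PartialOrder M]
variable {E : Type v} [NormedAddCommGroup E] [NormedSpace ℂ E] [CompleteSpace E]

theorem isSemiInner_ip [HilbertModule M E] :
    IsSemiInner (fun (x : E) (a : M) => rmul x a) (fun x y : E => ip M x y) where
  add_right := HilbertModule.ip_add_right
  act_right := HilbertModule.ip_rmul
  star_swap := HilbertModule.star_ip
  self_nonneg := HilbertModule.ip_self_nonneg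

/-- The inner product as a sesquilinear map. -/
def ipₗ (M : Type u) (E : Type v) [NonUnitalCStarAlgebra M] [PartialOrder M]
    [NormedAddCommGroup E] [NormedSpace ℂ E] [CompleteSpace E] [HilbertModule M E] :
    E →ₗ⋆[ℂ] E →ₗ[ℂ] M :=
  LinearMap.mk₂'ₛₗ (starRingEnd ℂ) (RingHom.id ℂ) (fun x y => ip M x y)
    (fun x y z => by
      change HilbertModule.ip (x + y) z = HilbertModule.ip x z + HilbertModule.ip y z
      rw [← HilbertModule.star_ip z, HilbertModule.ip_add_right, star_add,
        HilbertModule.star_ip, HilbertModule.star_ip])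
    (fun c x y => by
      change HilbertModule.ip (c • x) y = star c • HilbertModule.ip x y
      rw [← HilbertModule.star_ip y, HilbertModule.ip_smul_right, star_smul,
        HilbertModule.star_ip])
    HilbertModule.ip_add_right HilbertModule.ip_smul_right

@[simp] theorem ipₗ_apply [HilbertModule M E] (x y : E) : ipₗ M E x y = ip M x y := rfl

/-- `⟨a x, a x⟩ ≤ ‖a‖² ⟨x, x⟩`. -/
theorem ip_lmul_self_le [StarOrderedRing M] [Correspondence M E] (a : M) (x : E) :
    ip M (lmul a x) (lmul a x) ≤ (‖a‖ ^ 2 : ℝ) • ip M x x := by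
  let _ : PartialOrder (Unitization ℂ M) := CStarAlgebra.spectralOrder _
  have _ : StarOrderedRing (Unitization ℂ M) := CStarAlgebra.spectralOrderedRing _
  have h1 : star (a : Unitization ℂ M) * a ≤
      algebraMap ℝ (Unitization ℂ M) (‖(a : Unitization ℂ M)‖ ^ 2) :=
    CStarAlgebra.star_mul_le_algebraMap_norm_sq
  obtain ⟨b, hb⟩ := exists_eq_star_mul_self (sub_nonneg.2 h1)
  rw [Unitization.norm_inr] at hb
  have hfst : ((‖a‖ ^ 2 : ℝ) : ℂ) = star b.fst * b.fst := by
    have := congrArg (fun z : Unitization ℂ M => z.fst) hb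
    simpa [Unitization.algebraMap_eq_inl_comp, sub_eq_add_neg] using this
  have hsnd : -(star a * a) = star b.fst • b.snd + b.fst • star b.snd + star b.snd * b.snd := by
    have := congrArg (fun z : Unitization ℂ M => z.snd) hb
    simpa [Unitization.algebraMap_eq_inl_comp, sub_eq_add_neg] using this
  have h2 : 0 ≤ ip M (b.fst • x + lmul b.snd x) (b.fst • x + lmul b.snd x) :=
    HilbertModule.ip_self_nonneg _
  have h3 : ∀ c : M, ip M (lmul c x) x = ip M x (lmul (star c) x) :=
    fun c => Correspondence.ip_lmul c x x
  have h4 : ∀ c : M, ip M (lmul c x) (lmul c x) = ip M x (lmul (star c * c) x) := fun c => by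
    rw [lmul, lmul, Correspondence.lmul_mul]; exact Correspondence.ip_lmul c x _
  have h5 : ip M (b.fst • x + lmul b.snd x) (b.fst • x + lmul b.snd x) =
      ((‖a‖ ^ 2 : ℝ) : ℂ) • ip M x x + ip M x (lmul (-(star a * a)) x) := by
    rw [hfst, hsnd]
    simp only [← ipₗ_apply, map_add, map_smulₛₗ, LinearMap.add_apply, LinearMap.smul_apply, lmul,
      RingHom.id_apply] at h3 h4 ⊢
    rw [h3, h4]
    simp only [smul_add, smul_smul, starRingEnd_apply, mul_comm]
    abel
  rw [h5] at h2
  have h6 : ip M x (lmul (-(star a * a)) x) = -ip M x (lmul (star a * a) x) := by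
    rw [← ipₗ_apply, ← ipₗ_apply, lmul, lmul, map_neg, LinearMap.neg_apply, map_neg]
  rw [h6, ← sub_eq_add_neg, sub_nonneg, Complex.coe_smul] at h2
  rw [h4]
  exact h2

end HilbertModule

/-! ## The Hilbert space `E ⊗_π H` -/

section HilbertTensor

variable {M : Type u} [NonUnitalCStarAlgebra M] [PartialOrder M]
variable {H : Type w} [NormedAddCommGroup H] [InnerProductSpace ℂ H] [CompleteSpace H]

variable (π : M →⋆ₙₐ[ℂ] (H →L[ℂ] H))
variable (E : Type v) [NormedAddCommGroup E] [NormedSpace ℂ E] [CompleteSpace E]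

section PreInner

variable [HilbertModule M E]

/-- The functional `y ⊗ k ↦ ⟨h, π(⟨x, y⟩) k⟩` on `E ⊗ H`. -/
noncomputable def preInnerAux (x : E) (h : H) : E ⊗[ℂ] H →ₗ[ℂ] ℂ :=
  TensorProduct.lift (LinearMap.mk₂ ℂ
    (fun (y : E) (k : H) => ⟪h, π (ipₗ M E x y) k⟫_ℂ)
    (fun y z k => by
      rw [map_add, map_add, add_apply, inner_add_right])
    (fun c y k => by
      rw [map_smul, map_smul, smul_apply, inner_smul_right]; rfl)
    (fun y k l => by rw [map_add, inner_add_right])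
    (fun c y k => by rw [map_smul, inner_smul_right]; rfl))

theorem preInnerAux_tmul (x y : E) (h k : H) :
    preInnerAux π E x h (y ⊗ₜ[ℂ] k) = ⟪h, π (ipₗ M E x y) k⟫_ℂ := rfl

/-- The semi-inner product on `E ⊗ H`, determined by `⟨x ⊗ h, y ⊗ k⟩ = ⟨h, π(⟨x, y⟩) k⟩`. -/
noncomputable def preInner : E ⊗[ℂ] H →ₗ⋆[ℂ] E ⊗[ℂ] H →ₗ[ℂ] ℂ :=
  TensorProduct.lift (LinearMap.mk₂'ₛₗ (starRingEnd ℂ) (starRingEnd ℂ)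
    (preInnerAux π E)
    (fun x z h => TensorProduct.ext' fun y k => by
      rw [LinearMap.add_apply]; simp only [preInnerAux_tmul, map_add, LinearMap.add_apply, add_apply, inner_add_right])
    (fun c x h => TensorProduct.ext' fun y k => by
      rw [LinearMap.smul_apply]
      simp only [preInnerAux_tmul, map_smulₛₗ, RingHom.id_apply, LinearMap.smul_apply, smul_apply,
        inner_smul_right, smul_eq_mul])
    (fun x h k => TensorProduct.ext' fun y l => by
      rw [LinearMap.add_apply]; simp only [preInnerAux_tmul, inner_add_left])
    (fun c x h => TensorProduct.ext' fun y k => by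
      rw [LinearMap.smul_apply]; simp only [preInnerAux_tmul, inner_smul_left, smul_eq_mul]))

theorem preInner_tmul (x y : E) (h k : H) :
    preInner π E (x ⊗ₜ[ℂ] h) (y ⊗ₜ[ℂ] k) = ⟪h, π (ip M x y) k⟫_ℂ := rfl

theorem preInner_sum {n m : ℕ} (x : Fin n → E) (h : Fin n → H) (y : Fin m → E) (k : Fin m → H) :
    preInner π E (∑ i, x i ⊗ₜ[ℂ] h i) (∑ i, y i ⊗ₜ[ℂ] k i) =
      ∑ i, ∑ j, ⟪h i, π (ip M (x i) (y j)) (k j)⟫_ℂ := by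
  simp only [map_sum, LinearMap.sum_apply, preInner_tmul]
  exact Finset.sum_comm

end PreInner

variable {E}

theorem exists_tmul_sum (t : E ⊗[ℂ] H) :
    ∃ (n : ℕ) (x : Fin n → E) (h : Fin n → H), t = ∑ i, x i ⊗ₜ[ℂ] h i := by
  obtain ⟨S, hS⟩ := TensorProduct.exists_finset (R := ℂ) t
  refine ⟨S.card, fun i => (S.equivFin.symm i).1.1, fun i => (S.equivFin.symm i).1.2, ?_⟩
  rw [hS, ← Finset.sum_coe_sort, ← S.equivFin.symm.sum_comp]

theorem re_sum_inner_nonneg [StarOrderedRing M] {r : E → M → E} {s : E → E → M}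
    (hs : IsSemiInner r s) {n : ℕ} (x : Fin n → E) (h : Fin n → H) :
    0 ≤ (∑ i, ∑ j, ⟪h i, π (s (x i) (x j)) (h j)⟫_ℂ).re := by
  obtain ⟨B, hB⟩ := hs.exists_gram x
  have hB' : ∀ i j, ⟪h i, π (s (x i) (x j)) (h j)⟫_ℂ =
      ∑ k, ⟪π (B k i) (h i), π (B k j) (h j)⟫_ℂ := by
    intro i j
    rw [hB, map_sum, sum_apply, inner_sum]
    refine Finset.sum_congr rfl fun k _ => ?_
    rw [map_mul, map_star, mul_apply_eq_comp, ContinuousLinearMap.star_eq_adjoint,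
      ContinuousLinearMap.adjoint_inner_right]
  have : ∑ i, ∑ j, ⟪h i, π (s (x i) (x j)) (h j)⟫_ℂ =
      ∑ k, ⟪∑ i, π (B k i) (h i), ∑ i, π (B k i) (h i)⟫_ℂ := by
    simp only [hB', inner_sum, sum_inner]
    rw [Finset.sum_congr rfl fun i _ => Finset.sum_comm, Finset.sum_comm]
    exact Finset.sum_congr rfl fun k _ => Finset.sum_comm
  rw [this, Complex.re_sum]
  exact Finset.sum_nonneg fun k _ => inner_self_nonneg (𝕜 := ℂ)

/-- The algebraic tensor product `E ⊗ H`, tagged with the representation `π` that determines its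
semi-inner product `⟨x ⊗ h, y ⊗ k⟩ = ⟨h, π(⟨x, y⟩) k⟩`. -/
def PreTensor (_π : M →⋆ₙₐ[ℂ] (H →L[ℂ] H)) (E : Type v) [NormedAddCommGroup E]
    [NormedSpace ℂ E] : Type (max v w) := E ⊗[ℂ] H

/-- The identification of `E ⊗ H` with its tagged copy. -/
def toPre : E ⊗[ℂ] H → PreTensor π E := fun t => t

noncomputable instance : AddCommGroup (PreTensor π E) := inferInstanceAs (AddCommGroup (E ⊗[ℂ] H))
noncomputable instance : Module ℂ (PreTensor π E) := inferInstanceAs (Module ℂ (E ⊗[ℂ] H))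

variable [StarOrderedRing M] [HilbertModule M E]

/-- The semi-inner product space structure on `E ⊗ H`. -/
noncomputable instance : PreInnerProductSpace.Core ℂ (PreTensor π E) where
  inner s t := preInner π E s t
  conj_inner_symm s t := by
    change starRingEnd ℂ (preInner π E (t : E ⊗[ℂ] H) (s : E ⊗[ℂ] H)) =
      preInner π E (s : E ⊗[ℂ] H) (t : E ⊗[ℂ] H)
    obtain ⟨n, x, h, hs⟩ := exists_tmul_sum (s : E ⊗[ℂ] H)
    obtain ⟨m, y, k, ht⟩ := exists_tmul_sum (t : E ⊗[ℂ] H)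
    rw [hs, ht, preInner_sum, preInner_sum]
    simp only [map_sum]
    rw [Finset.sum_comm]
    refine Finset.sum_congr rfl fun i _ => Finset.sum_congr rfl fun j _ => ?_
    rw [inner_conj_symm, ip, ip, ← HilbertModule.star_ip, map_star,
      ContinuousLinearMap.star_eq_adjoint, ContinuousLinearMap.adjoint_inner_left]
  re_inner_nonneg t := by
    change 0 ≤ (preInner π E (t : E ⊗[ℂ] H) (t : E ⊗[ℂ] H)).re
    obtain ⟨n, x, h, ht⟩ := exists_tmul_sum (t : E ⊗[ℂ] H)
    rw [ht, preInner_sum]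
    exact re_sum_inner_nonneg π isSemiInner_ip x h
  add_left s t r := LinearMap.map_add₂ (preInner π E) (s : E ⊗[ℂ] H) (t : E ⊗[ℂ] H) (r : E ⊗[ℂ] H)
  smul_left s t c := LinearMap.map_smulₛₗ₂ (preInner π E) c (s : E ⊗[ℂ] H) (t : E ⊗[ℂ] H)

noncomputable instance : SeminormedAddCommGroup (PreTensor π E) :=
  InnerProductSpace.Core.toSeminormedAddCommGroup (𝕜 := ℂ)

noncomputable instance : InnerProductSpace ℂ (PreTensor π E) :=
  InnerProductSpace.ofCore _

theorem inner_toPre (s t : E ⊗[ℂ] H) :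
    ⟪toPre π s, toPre π t⟫_ℂ = preInner π E s t := rfl

variable (E) in
/-- The Hilbert space `E ⊗_π H`: the (separated) completion of `E ⊗ H`. -/
abbrev HilbertTensor : Type (max v w) := UniformSpace.Completion (PreTensor π E)

/-- The elementary tensor `x ⊗ h` in `E ⊗_π H`. -/
noncomputable def tmul (x : E) (h : H) : HilbertTensor π E :=
  (toPre π (x ⊗ₜ[ℂ] h) : PreTensor π E)

theorem inner_tmul (x y : E) (h k : H) :
    ⟪tmul π x h, tmul π y k⟫_ℂ = ⟪h, π (ip M x y) k⟫_ℂ := by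
  rw [tmul, tmul, UniformSpace.Completion.inner_coe, inner_toPre, preInner_tmul]

/-- Right-module maps `L` with `⟨L x, L x⟩ ≤ c² ⟨x, x⟩`. -/
structure IsModuleBounded {F : Type v} [NormedAddCommGroup F] [NormedSpace ℂ F] [CompleteSpace F]
    [HilbertModule M F] (c : ℝ) (L : E →ₗ[ℂ] F) : Prop where
  nonneg : 0 ≤ c
  map_rmul : ∀ (x : E) (a : M), L (rmul x a) = rmul (L x) a
  le : ∀ x, ip M (L x) (L x) ≤ (c ^ 2 : ℝ) • ip M x x

variable {F : Type v} [NormedAddCommGroup F] [NormedSpace ℂ F] [CompleteSpace F]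
  [HilbertModule M F]

theorem IsModuleBounded.isSemiInner {c : ℝ} {L : E →ₗ[ℂ] F} (hL : IsModuleBounded (M := M) c L) :
    IsSemiInner (fun (x : E) (a : M) => rmul x a)
      (fun x y : E => (c ^ 2 : ℝ) • ip M x y - ip M (L x) (L y)) where
  add_right x y z := by
    simp only [← ipₗ_apply, map_add, smul_add]; abel
  act_right x y a := by
    simp only [hL.map_rmul, rmul, ip, HilbertModule.ip_rmul, sub_mul, smul_mul_assoc]
  star_swap x y := by
    simp only [ip, star_sub, star_smul, HilbertModule.star_ip, star_trivial]
  self_nonneg x := sub_nonneg.2 (hL.le x)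

/-- `L ⊗ I` on the algebraic tensor product. -/
noncomputable def preAmpliation (L : E →ₗ[ℂ] F) : PreTensor π E →ₗ[ℂ] PreTensor π F :=
  (LinearMap.rTensor H L : E ⊗[ℂ] H →ₗ[ℂ] F ⊗[ℂ] H)

theorem preAmpliation_norm_le {c : ℝ} {L : E →ₗ[ℂ] F} (hL : IsModuleBounded (M := M) c L)
    (t : PreTensor π E) : ‖preAmpliation π L t‖ ≤ c * ‖t‖ := by
  obtain ⟨n, x, h, ht⟩ := exists_tmul_sum (t : E ⊗[ℂ] H)
  have h1 : ‖t‖ ^ 2 = (∑ i, ∑ j, ⟪h i, π (ip M (x i) (x j)) (h j)⟫_ℂ).re := by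
    rw [← preInner_sum, ← ht]
    exact norm_sq_eq_re_inner (𝕜 := ℂ) t
  have h2 : ‖preAmpliation π L t‖ ^ 2 =
      (∑ i, ∑ j, ⟪h i, π (ip M (L (x i)) (L (x j))) (h j)⟫_ℂ).re := by
    have e : (preAmpliation π L t : F ⊗[ℂ] H) = ∑ i, (L (x i)) ⊗ₜ[ℂ] h i := by
      change LinearMap.rTensor H L (t : E ⊗[ℂ] H) = _
      rw [ht, map_sum]; rfl
    rw [← preInner_sum, ← e]
    exact norm_sq_eq_re_inner (𝕜 := ℂ) (preAmpliation π L t)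
  have h3 := re_sum_inner_nonneg π hL.isSemiInner x h
  have h4 : (∑ i, ∑ j, ⟪h i, π ((c ^ 2 : ℝ) • ip M (x i) (x j) -
      ip M (L (x i)) (L (x j))) (h j)⟫_ℂ).re = c ^ 2 * ‖t‖ ^ 2 - ‖preAmpliation π L t‖ ^ 2 := by
    rw [h1, h2]
    simp only [← Complex.coe_smul, map_sub, map_smul, sub_apply, smul_apply, inner_sub_right,
      inner_smul_right, Finset.sum_sub_distrib, ← Finset.mul_sum, Complex.sub_re,
      Complex.re_ofReal_mul]
  rw [h4, sub_nonneg, ← mul_pow] at h3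
  exact le_of_sq_le_sq h3 (mul_nonneg hL.nonneg (norm_nonneg t))

/-- The operator `L ⊗ I : E ⊗_π H → F ⊗_π H` induced by a bounded module map `L`. -/
noncomputable def ampliation {c : ℝ} (L : E →ₗ[ℂ] F) (hL : IsModuleBounded (M := M) c L) :
    HilbertTensor π E →L[ℂ] HilbertTensor π F :=
  ((preAmpliation π L).mkContinuous c (preAmpliation_norm_le π hL)).completion

theorem ampliation_tmul {c : ℝ} (L : E →ₗ[ℂ] F) (hL : IsModuleBounded (M := M) c L) (x : E)
    (h : H) : ampliation π L hL (tmul π x h) = tmul π (L x) h := by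
  rw [tmul, ampliation, ContinuousLinearMap.completion_apply_coe]
  rfl

theorem ampliation_norm_le {c : ℝ} (L : E →ₗ[ℂ] F) (hL : IsModuleBounded (M := M) c L)
    (x : HilbertTensor π E) : ‖ampliation π L hL x‖ ≤ c * ‖x‖ := by
  induction x using UniformSpace.Completion.induction_on with
  | hp => exact isClosed_le (by fun_prop) (by fun_prop)
  | ih t =>
    rw [ampliation, ContinuousLinearMap.completion_apply_coe, UniformSpace.Completion.norm_coe,
      UniformSpace.Completion.norm_coe]
    exact preAmpliation_norm_le π hL t

end HilbertTensor

/-! ## The shift on a Hilbert direct sum -/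

section Shift

variable {G : ℕ → Type w} [∀ n, NormedAddCommGroup (G n)] [∀ n, InnerProductSpace ℂ (G n)]

/-- The function underlying `lpShift`. -/
def shiftFun (n : ℕ) (L : ∀ {m l : ℕ}, n + m = l → G m →L[ℂ] G l) (x : ∀ m, G m) (l : ℕ) : G l :=
  if h : n ≤ l then L (Nat.add_sub_of_le h) (x (l - n)) else 0

variable {n : ℕ} {L : ∀ {m l : ℕ}, n + m = l → G m →L[ℂ] G l} {c : ℝ}

theorem shiftFun_bound (hL : ∀ {m l : ℕ} (h : n + m = l) x, ‖L h x‖ ≤ c * ‖x‖)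
    (x : lp G 2) :
    Summable (fun l => ‖shiftFun n L x l‖ ^ 2) ∧
      ∑' l, ‖shiftFun n L x l‖ ^ 2 ≤ c ^ 2 * ‖x‖ ^ 2 := by
  have hx := lp.hasSum_norm (p := 2) (by norm_num) x
  simp only [ENNReal.toReal_ofNat, Real.rpow_ofNat] at hx
  have hx' := hx.mul_left (c ^ 2)
  have hle : ∀ l, ‖shiftFun n L x (l + n)‖ ^ 2 ≤ c ^ 2 * ‖x l‖ ^ 2 := by
    intro l
    have e : ‖x (l + n - n)‖ = ‖x l‖ := by rw [Nat.add_sub_cancel]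
    rw [shiftFun, dif_pos (Nat.le_add_left n l), ← mul_pow, ← e]
    exact pow_le_pow_left₀ (norm_nonneg _) (hL _ _) 2
  have hs : Summable (fun l => ‖shiftFun n L x (l + n)‖ ^ 2) :=
    Summable.of_nonneg_of_le (fun _ => by positivity) hle hx'.summable
  have hs' := (summable_nat_add_iff (f := fun l => ‖shiftFun n L x l‖ ^ 2) n).1 hs
  refine ⟨hs', ?_⟩
  rw [← hs'.sum_add_tsum_nat_add n, Finset.sum_eq_zero, zero_add]
  · exact (hs.tsum_le_tsum hle hx'.summable).trans_eq hx'.tsum_eq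
  · intro i hi
    rw [shiftFun, dif_neg (by simpa using hi)]
    simp

/-- The operator `(x₀, x₁, …) ↦ (0, …, 0, L x₀, L x₁, …)` with `n` leading zeros on the Hilbert
direct sum of the spaces `G m`, where `L` maps `G m` into `G (n + m)`. -/
noncomputable def lpShift (n : ℕ) (L : ∀ {m l : ℕ}, n + m = l → G m →L[ℂ] G l) (c : ℝ) (hc : 0 ≤ c)
    (hL : ∀ {m l : ℕ} (h : n + m = l) x, ‖L h x‖ ≤ c * ‖x‖) : lp G 2 →L[ℂ] lp G 2 :=
  LinearMap.mkContinuous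
    { toFun := fun x => ⟨shiftFun n L x, memℓp_gen (by
        simpa using (shiftFun_bound hL x).1)⟩
      map_add' := fun x y => by
        ext l
        change shiftFun n L (x + y : lp G 2) l = shiftFun n L x l + shiftFun n L y l
        by_cases h : n ≤ l <;> simp [shiftFun, h]
      map_smul' := fun a x => by
        ext l
        by_cases h : n ≤ l <;> simp [shiftFun, h] }
    c
    (fun x => by
      refine le_of_sq_le_sq ?_ (mul_nonneg hc (norm_nonneg x))
      have := lp.norm_rpow_eq_tsum (p := 2) (E := G) (by norm_num)
        ⟨shiftFun n L x, memℓp_gen (by simpa using (shiftFun_bound hL x).1)⟩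
      simp only [ENNReal.toReal_ofNat, Real.rpow_ofNat] at this
      rw [mul_pow]
      exact this.trans_le (shiftFun_bound hL x).2)

theorem shiftFun_add (x : ∀ m, G m) (i : ℕ) : shiftFun n L x (n + i) = L rfl (x i) := by
  have key : ∀ (p : ℕ) (hp : n + p = n + i), L hp (x p) = L rfl (x i) := by
    intro p hp
    obtain rfl : p = i := by omega
    rfl
  rw [shiftFun, dif_pos (Nat.le_add_right n i)]
  exact key _ _

theorem lpShift_single {hc : 0 ≤ c} (hL : ∀ {m l : ℕ} (h : n + m = l) x, ‖L h x‖ ≤ c * ‖x‖)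
    {m l : ℕ} (h : n + m = l) (v : G m) :
    lpShift n L c hc hL (lp.single 2 m v) = lp.single 2 l (L h v) := by
  subst h
  ext j
  change shiftFun n L (lp.single 2 m v : lp G 2) j = _
  by_cases hj : n ≤ j
  · obtain ⟨i, rfl⟩ := Nat.exists_eq_add_of_le hj
    rw [shiftFun_add]
    by_cases him : i = m
    · subst him
      rw [lp.single_apply_self, lp.single_apply_self]
    · rw [lp.single_apply_ne _ _ _ him, lp.single_apply_ne _ _ _ (by omega), map_zero]
  · rw [shiftFun, dif_neg hj, lp.single_apply_ne _ _ _ (by omega)]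

end Shift

/-! ## `W*`-algebras and normality -/

section Normal

variable (M : Type u) [NonUnitalCStarAlgebra M] [PartialOrder M]

/-- `M` is a `W*`-algebra: it is isometric to the dual of a Banach space (Sakai).  This is Mathlib's
`WStarAlgebra`, without presupposing a unit (which exists automatically). -/
def IsWStarAlgebra : Prop :=
  ∃ (P : Type u) (_ : NormedAddCommGroup P) (_ : NormedSpace ℂ P) (_ : CompleteSpace P),
    Nonempty (StrongDual ℂ P ≃ₗᵢ⋆[ℂ] M)

variable {M} in
/-- Positive functionals that preserve suprema of bounded increasing nets of positive elements. -/
def IsNormalPositive (ω : M →L[ℂ] ℂ) : Prop :=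
  (∀ a, 0 ≤ a → 0 ≤ ω a) ∧
    ∀ D : Set M, D.Nonempty → DirectedOn (· ≤ ·) D → (∀ a ∈ D, 0 ≤ a) → ∀ s, IsLUB D s →
      IsLUB ((fun a => (ω a).re) '' D) (ω s).re

/-- The predual `M_*` of a `W*`-algebra, as the span of the normal positive functionals. -/
noncomputable def normalFunctionals : Submodule ℂ (M →L[ℂ] ℂ) :=
  Submodule.span ℂ {ω | IsNormalPositive ω}

variable (E : Type v) [NormedAddCommGroup E] [NormedSpace ℂ E] [CompleteSpace E]

/-- The predual `E_*` of a self-dual Hilbert module over a `W*`-algebra: the norm closure of the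
span of the functionals `ω(⟨η, ·⟩)` with `ω` normal and `η ∈ E`. -/
noncomputable def sigmaFunctionals [HilbertModule M E] : Submodule ℂ (E →L[ℂ] ℂ) :=
  (Submodule.span ℂ {φ : E →L[ℂ] ℂ |
    ∃ ω ∈ normalFunctionals M, ∃ η : E, ∀ x, φ x = ω (ip M η x)}).topologicalClosure

/-- The `σ`-topology of `E`: the weak topology induced by `E_*`. -/
@[reducible] noncomputable def sigmaTopology [HilbertModule M E] : TopologicalSpace E :=
  ⨅ φ ∈ sigmaFunctionals M E, TopologicalSpace.induced (fun x => φ x) inferInstance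

/-- `E` is self-dual: every bounded module map `E → M` is of the form `⟨η, ·⟩`. -/
def IsSelfDual [HilbertModule M E] : Prop :=
  ∀ f : E →L[ℂ] M, (∀ (x : E) (a : M), f (rmul x a) = f x * a) →
    ∃ η : E, ∀ x, f x = ip M η x

/-- The left action of `M` on `E` is normal. -/
def HasNormalLeftAction [Correspondence M E] : Prop :=
  ∀ ω ∈ normalFunctionals M, ∀ ξ η : E,
    ∃ ω' ∈ normalFunctionals M, ∀ a, ω' a = ω (ip M ξ (lmul a η))

end Normal

/-! ## `A*`-algebras, `A*`-correspondences: the two settings `C*` and `W*` -/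

/-- The two settings in which everything takes place. -/
inductive Setting
  /-- `C*`-algebras and `C*`-correspondences -/
  | cstar
  /-- `W*`-algebras and `W*`-correspondences -/
  | wstar

namespace Setting

variable (k : Setting)

/-- `M` is a `C*`- resp. `W*`-algebra. -/
def IsAlgebra (M : Type u) [NonUnitalCStarAlgebra M] : Prop :=
  match k with
  | cstar => True
  | wstar => IsWStarAlgebra M

/-- `E` is a `C*`- resp. `W*`-correspondence. -/
def IsCorrespondence (M : Type u) [NonUnitalCStarAlgebra M] [PartialOrder M] (E : Type v)
    [NormedAddCommGroup E] [NormedSpace ℂ E] [CompleteSpace E] [Correspondence M E] : Prop :=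
  match k with
  | cstar => True
  | wstar => IsSelfDual M E ∧ HasNormalLeftAction M E

/-- Density in norm resp. in the `σ`-topology. -/
def IsDense (M : Type u) [NonUnitalCStarAlgebra M] [PartialOrder M] {E : Type v}
    [NormedAddCommGroup E] [NormedSpace ℂ E] [CompleteSpace E] [HilbertModule M E]
    (s : Set E) : Prop :=
  match k with
  | cstar => Dense s
  | wstar => @Dense E (sigmaTopology M E) s

/-- A representation of a `C*`-algebra is a `*`-homomorphism into the bounded operators; for
`W*`-algebras it is also required to be normal. -/
def IsRepresentation {M : Type u} [NonUnitalCStarAlgebra M] [PartialOrder M] {H : Type w}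
    [NormedAddCommGroup H] [InnerProductSpace ℂ H] [CompleteSpace H]
    (π : M →⋆ₙₐ[ℂ] (H →L[ℂ] H)) : Prop :=
  match k with
  | cstar => True
  | wstar => ∀ x y : H, ∃ ω ∈ normalFunctionals M, ∀ a, ω a = ⟪x, π a y⟫_ℂ

/-- The correspondence `K` with the map `(x, y) ↦ x ⊗ y := τ x y` is the tensor product `E ⊗ F` of
the correspondences `E` and `F`.  In the `C*`-setting this is the interior tensor product (the
elementary tensors span a dense subspace); in the `W*`-setting it is the self-dual extension of the
latter (`K` is self-dual and the elementary tensors span a `σ`-dense subspace).  These properties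
determine `K` and `τ` up to a unique unitary. -/
structure IsTensorProduct (M : Type u) [NonUnitalCStarAlgebra M] [PartialOrder M]
    {E F K : Type v} [NormedAddCommGroup E] [NormedSpace ℂ E] [CompleteSpace E]
    [Correspondence M E] [NormedAddCommGroup F] [NormedSpace ℂ F] [CompleteSpace F]
    [Correspondence M F] [NormedAddCommGroup K] [NormedSpace ℂ K] [CompleteSpace K]
    [Correspondence M K] (τ : E →ₗ[ℂ] F →ₗ[ℂ] K) : Prop where
  isCorrespondence : k.IsCorrespondence M K
  balanced : ∀ x (a : M) y, τ (rmul x a) y = τ x (lmul a y)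
  ip_tmul : ∀ x y x' y', ip M (τ x y) (τ x' y') = ip M y (lmul (ip M x x') y')
  lmul_tmul : ∀ (a : M) x y, lmul a (τ x y) = τ (lmul a x) y
  rmul_tmul : ∀ x y (a : M), rmul (τ x y) a = τ x (rmul y a)
  dense : k.IsDense M (Submodule.span ℂ {z : K | ∃ x y, z = τ x y} : Set K)

/-- The bilinear map `u : E × F → G` is of the form `u x y = U (x ⊗ y)` for a coisometric adjointable
bimodule map `U : E ⊗ F → G`; `V` is the adjoint of `U`, and `U V = 1`. -/
def IsCoisometric (M : Type u) [NonUnitalCStarAlgebra M] [PartialOrder M]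
    {E F G : Type v} [NormedAddCommGroup E] [NormedSpace ℂ E] [CompleteSpace E]
    [Correspondence M E] [NormedAddCommGroup F] [NormedSpace ℂ F] [CompleteSpace F]
    [Correspondence M F] [NormedAddCommGroup G] [NormedSpace ℂ G] [CompleteSpace G]
    [Correspondence M G] (u : E →ₗ[ℂ] F →ₗ[ℂ] G) : Prop :=
  ∃ (K : Type v) (_ : NormedAddCommGroup K) (_ : NormedSpace ℂ K) (_ : CompleteSpace K)
    (_ : Correspondence M K) (τ : E →ₗ[ℂ] F →ₗ[ℂ] K) (U : K →L[ℂ] G) (V : G →L[ℂ] K),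
    k.IsTensorProduct M τ ∧ (∀ x y, U (τ x y) = u x y) ∧
    (∀ (a : M) z, U (lmul a z) = lmul a (U z)) ∧ (∀ z (a : M), U (rmul z a) = rmul (U z) a) ∧
    (∀ z g, ip M (U z) g = ip M z (V g)) ∧ ∀ g, U (V g) = g

variable {k} in
theorem IsCoisometric.isModuleBounded {M : Type u} [NonUnitalCStarAlgebra M] [PartialOrder M]
    [StarOrderedRing M]
    {E F G : Type v} [NormedAddCommGroup E] [NormedSpace ℂ E] [CompleteSpace E]
    [Correspondence M E] [NormedAddCommGroup F] [NormedSpace ℂ F] [CompleteSpace F]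
    [Correspondence M F] [NormedAddCommGroup G] [NormedSpace ℂ G] [CompleteSpace G]
    [Correspondence M G] {u : E →ₗ[ℂ] F →ₗ[ℂ] G} (hu : k.IsCoisometric M u) (x : E) :
    IsModuleBounded (M := M) ‖x‖ (u x) := by
  obtain ⟨K, _, _, _, _, τ, U, V, hτ, hU, -, hUr, hadj, hUV⟩ := hu
  refine ⟨norm_nonneg x, fun y a => ?_, fun y => ?_⟩
  · rw [← hU, ← hU, ← hUr, hτ.rmul_tmul]
  · have hUle : ∀ z, ip M (U z) (U z) ≤ ip M z z := by
      intro z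
      have h1 : ip M (V (U z)) z = ip M (U z) (U z) := by
        rw [ip, ip, ← HilbertModule.star_ip z, ← HilbertModule.star_ip (U z)]
        exact congrArg star (hadj z (U z)).symm
      have h2 : ip M (V (U z)) (V (U z)) = ip M (U z) (U z) := by
        rw [← hadj, hUV]
      have h3 : 0 ≤ ip M (z - V (U z)) (z - V (U z)) := HilbertModule.ip_self_nonneg _
      have h4 : ip M (z - V (U z)) (z - V (U z)) = ip M z z - ip M (U z) (U z) := by
        have h5 : ip M z (V (U z)) = ip M (U z) (U z) := (hadj z (U z)).symm
        rw [← ipₗ_apply, map_sub, map_sub, LinearMap.sub_apply, LinearMap.sub_apply]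
        simp only [ipₗ_apply]
        rw [h1, h2, h5]; abel
      rwa [h4, sub_nonneg] at h3
    rw [← hU]
    refine (hUle _).trans ?_
    rw [hτ.ip_tmul]
    have hx : 0 ≤ ip M x x := HilbertModule.ip_self_nonneg x
    obtain ⟨b, hb⟩ := exists_eq_star_mul_self hx
    have e1 : ip M y (lmul (ip M x x) y) = ip M (lmul b y) (lmul b y) := by
      rw [hb, lmul, Correspondence.lmul_mul]
      exact (Correspondence.ip_lmul (M := M) b y _).symm
    have e2 : ‖b‖ ^ 2 = ‖x‖ ^ 2 := by
      rw [HilbertModule.norm_sq (M := M) x]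
      change _ = ‖ip M x x‖
      rw [hb, CStarRing.norm_star_mul_self, sq]
    rw [e1, ← e2]
    exact ip_lmul_self_le b y

end Setting

/-! ## Subproduct systems -/

/-- A subproduct system `X = (X(n))_{n ≥ 0}` over `M`, with `X(0) = M` (through the unitary
bimodule map `unit`) and coisometric adjointable bimodule maps
`U_{n,m} : X(n) ⊗ X(m) → X(n+m)`, `U_{n,m}(ζ ⊗ η) = mul ζ η`.  The adjoint of `U_{n,m}` is an
isometric bimodule map `X(n+m) → X(n) ⊗ X(m)` with orthogonally complemented range; a standard
subproduct system is one for which these maps are inclusions of submodules, so that `U_{n,m}` is the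
restriction to `X(n) ⊗ X(m)` of the orthogonal projection `p_{n+m}` of `X(1)^{⊗(n+m)}` onto
`X(n+m)`.  To avoid transports, `mul` is indexed by a degree `l` with a proof of `n + m = l`. -/
structure SubproductSystem (k : Setting) (M : Type u) [NonUnitalCStarAlgebra M] [PartialOrder M]
    (X : ℕ → Type v) [∀ n, NormedAddCommGroup (X n)] [∀ n, NormedSpace ℂ (X n)]
    [∀ n, CompleteSpace (X n)] [∀ n, Correspondence M (X n)] where
  isAlgebra : k.IsAlgebra M
  isCorrespondence : ∀ n, k.IsCorrespondence M (X n)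
  unit : M ≃ₗ[ℂ] X 0
  ip_unit : ∀ a b, ip M (unit a) (unit b) = star a * b
  lmul_unit : ∀ a b, lmul a (unit b) = unit (a * b)
  rmul_unit : ∀ a b, rmul (unit a) b = unit (a * b)
  mul : ∀ {n m l : ℕ}, n + m = l → X n →ₗ[ℂ] X m →ₗ[ℂ] X l
  isCoisometric : ∀ {n m l : ℕ} (h : n + m = l), k.IsCoisometric M (mul h)
  mul_unit : ∀ {n : ℕ} (h : n + 0 = n) (ζ : X n) a, mul h ζ (unit a) = rmul ζ a
  unit_mul : ∀ {n : ℕ} (h : 0 + n = n) a (ζ : X n), mul h (unit a) ζ = lmul a ζ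
  mul_assoc : ∀ {n m l nm ml p : ℕ} (h₁ : n + m = nm) (h₂ : nm + l = p) (h₃ : m + l = ml)
    (h₄ : n + ml = p) (x : X n) (y : X m) (z : X l),
    mul h₂ (mul h₁ x y) z = mul h₄ x (mul h₃ y z)

section Main

variable {k : Setting} {M : Type u} [NonUnitalCStarAlgebra M] [PartialOrder M]
  {X : ℕ → Type v} [∀ n, NormedAddCommGroup (X n)] [∀ n, NormedSpace ℂ (X n)]
  [∀ n, CompleteSpace (X n)] [∀ n, Correspondence M (X n)]

section Fock

variable {E : Type w} [NormedAddCommGroup E] [InnerProductSpace ℂ E] [CompleteSpace E]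
  [StarOrderedRing M]

/-- The Hilbert space `F_X ⊗_π E`, where `F_X = ⨁ X(n)` is the Fock space: the Hilbert direct sum
of the spaces `X(n) ⊗_π E`. -/
abbrev Fock (π : M →⋆ₙₐ[ℂ] (E →L[ℂ] E)) (X : ℕ → Type v) [∀ n, NormedAddCommGroup (X n)]
    [∀ n, NormedSpace ℂ (X n)] [∀ n, CompleteSpace (X n)] [∀ n, Correspondence M (X n)] :
    Type (max v w) :=
  lp (fun n => HilbertTensor π (X n)) 2

/-- The operator `S_n(ζ) ⊗ I` on `F_X ⊗_π E`: it maps `η ⊗ e` to `U_{n,m}(ζ ⊗ η) ⊗ e` for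
`η ∈ X(m)`. -/
noncomputable def SubproductSystem.creation (S : SubproductSystem k M X)
    (π : M →⋆ₙₐ[ℂ] (E →L[ℂ] E)) (n : ℕ) (ζ : X n) : Fock π X →L[ℂ] Fock π X :=
  lpShift (G := fun m => HilbertTensor π (X m)) n
    (fun {_m _l} h => ampliation π (S.mul h ζ) ((S.isCoisometric h).isModuleBounded ζ)) ‖ζ‖
    (norm_nonneg ζ) (fun h x => ampliation_norm_le π (S.mul h ζ)
      ((S.isCoisometric h).isModuleBounded ζ) x)

theorem SubproductSystem.creation_single (S : SubproductSystem k M X)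
    (π : M →⋆ₙₐ[ℂ] (E →L[ℂ] E)) {n m l : ℕ} (h : n + m = l) (ζ : X n) (η : X m) (e : E) :
    S.creation π n ζ (lp.single 2 m (tmul π η e)) = lp.single 2 l (tmul π (S.mul h ζ η) e) := by
  rw [creation, lpShift_single (fun h x => ampliation_norm_le π (S.mul h ζ)
    ((S.isCoisometric h).isModuleBounded ζ) x) h, ampliation_tmul]

/-- The subspace `M ⊗_π E = X(0) ⊗_π E` of `F_X ⊗_π E`. -/
noncomputable def vacuum (π : M →⋆ₙₐ[ℂ] (E →L[ℂ] E)) (X : ℕ → Type v) [∀ n, NormedAddCommGroup (X n)]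
    [∀ n, NormedSpace ℂ (X n)] [∀ n, CompleteSpace (X n)] [∀ n, Correspondence M (X n)] :
    Submodule ℂ (Fock π X) where
  carrier := {x | ∀ n, n ≠ 0 → x n = 0}
  add_mem' hx hy n hn := by simp [hx n hn, hy n hn]
  zero_mem' n _ := rfl
  smul_mem' c x hx n hn := by simp [hx n hn]

end Fock

variable {H : Type w} [NormedAddCommGroup H] [InnerProductSpace ℂ H]

/-- A covariant representation `T = (T_n)` of `X` on `H`: linear maps `T_n : X(n) → B(H)` such that
`σ = T_0` is a `*`-representation of `M = X(0)`, `T_n(a ζ b) = σ(a) T_n(ζ) σ(b)`, and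
`T_{n+m}(U_{n,m}(ζ ⊗ η)) = T_n(ζ) T_m(η)`.  (No boundedness of the maps `T_n` is assumed.) -/
structure CovariantRep (S : SubproductSystem k M X) (H : Type w) [NormedAddCommGroup H]
    [InnerProductSpace ℂ H] where
  T : ∀ n, X n →ₗ[ℂ] (H →L[ℂ] H)
  map_star : ∀ a x y, ⟪T 0 (S.unit (star a)) x, y⟫_ℂ = ⟪x, T 0 (S.unit a) y⟫_ℂ
  covariant : ∀ n a (ζ : X n) b,
    T n (lmul a (rmul ζ b)) = T 0 (S.unit a) ∘L T n ζ ∘L T 0 (S.unit b)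
  map_mul : ∀ {n m l : ℕ} (h : n + m = l) (ζ : X n) (η : X m),
    T l (S.mul h ζ η) = T n ζ ∘L T m η

namespace CovariantRep

variable {S : SubproductSystem k M X} (T : CovariantRep S H)

/-- A subspace invariant under all `T_n(ζ)`; for `n = 0` this is invariance under `σ(M)`. -/
def IsInvariant (V : Submodule ℂ H) : Prop :=
  ∀ n (ζ : X n), ∀ v ∈ V, T.T n ζ v ∈ V

/-- The restriction `T|_V` to an invariant subspace. -/
noncomputable def restrict (V : Submodule ℂ H) (hV : T.IsInvariant V) : CovariantRep S V where
  T n :=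
    { toFun := fun ζ => (T.T n ζ ∘L V.subtypeL).codRestrict V fun v => hV n ζ v v.2
      map_add' := fun ζ η => by ext v; simp; rfl
      map_smul' := fun c ζ => by ext v; simp; rfl }
  map_star a x y := T.map_star a x y
  covariant n a ζ b := by ext v; simp [T.covariant]; rfl
  map_mul h ζ η := by ext v; simp [T.map_mul]; rfl

/-- `𝔏_n(V, T)`, the closed linear span of the vectors `T_n(ζ) v` with `ζ ∈ X(n)`, `v ∈ V`.  (As
`p_n` maps `X(1)^{⊗n}` onto `X(n)`, these are the vectors `T_n(p_n(ξ)) v` with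
`ξ ∈ X(1)^{⊗n}`.) -/
noncomputable def L (n : ℕ) (V : Submodule ℂ H) : Submodule ℂ H :=
  (Submodule.span ℂ {x : H | ∃ (ζ : X n), ∃ v ∈ V, x = T.T n ζ v}).topologicalClosure

/-- `V` is a wandering subspace for `T`. -/
def IsWandering (V : Submodule ℂ H) : Prop :=
  IsClosed (V : Set H) ∧ (∀ a : M, ∀ v ∈ V, T.T 0 (S.unit a) v ∈ V) ∧
    ∀ n, 1 ≤ n → V ⟂ T.L n V

/-- The subspace `V ⊖ 𝔏(V)`, where `𝔏(V) = 𝔏_1(V, T)`. -/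
noncomputable def wanderingPart (V : Submodule ℂ H) : Submodule ℂ H := V ⊓ (T.L 1 V)ᗮ

end CovariantRep

/-- A bounded operator between Hilbert spaces that is isometric on the orthogonal complement of its
kernel. -/
def IsPartialIsometry {K : Type w} {H : Type*} [NormedAddCommGroup K] [InnerProductSpace ℂ K]
    [NormedAddCommGroup H] [InnerProductSpace ℂ H] (A : K →L[ℂ] H) : Prop :=
  ∀ x ∈ (LinearMap.ker A.toLinearMap)ᗮ, ‖A x‖ = ‖x‖

end Main

end Subproduct

/-! Write $K=\ker\Pi$ and $\mathcal S=\mathrm{ran}\,\Pi$. A partial isometry satisfies $\langle\Pi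
x,\Pi y\rangle=\langle x,y\rangle$ as soon as $x\in K^\perp$, with $y$ arbitrary. Together with the
intertwining relation this gives $\langle\Pi x,T_n(\zeta)\Pi y\rangle=\langle x,(S_n(\zeta)\otimes
I)y\rangle$ (`inner_map_T`), so orthogonality questions in $\mathcal S$ become questions about
creation operators on the Fock space.

Every vector of $\mathcal S$ is $\Pi x$ with $x\in K^\perp$, and it is orthogonal to $\mathfrak
L(\mathcal S)$ exactly when $x$ is orthogonal to the ranges of all $S_1(\zeta)\otimes I$. These
ranges vanish in degree zero and together are total in each positive degree, hence the condition
says that $x$ lies in $\mathcal M\otimes_\pi\mathcal E$. This is the formula for $\mathcal W$. Since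
$S_n(\zeta)\otimes I$ also has no degree-zero part for every $n\ge1$, the formula yields $\mathcal
W\perp T_n(\zeta)\mathcal S$ for all such $n$, so $\mathcal W$ is wandering. No bound on $T_n$ in
terms of $\|\zeta\|$ enters.

The analytic point is totality of the vectors $U_{1,m}(\zeta\otimes\eta)\otimes e$ in
$X(m+1)\otimes_\pi\mathcal E$ (`Setting.IsCoisometric.eq_zero_of_inner_tmul`). In the $C^*$-setting
it follows from norm density and surjectivity of $U_{1,m}$. In the $W^*$-setting elementary tensors
are only $\sigma$-dense, and normality of $\pi$ makes the relevant functionals $\sigma$-continuous.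
-/

namespace Subproduct

/-! ### Total sets in $E\otimes_\pi H$ and $\sigma$-continuous functionals -/

section HilbertTensor

variable {M : Type u} [NonUnitalCStarAlgebra M] [PartialOrder M] [StarOrderedRing M]
variable {H : Type w} [NormedAddCommGroup H] [InnerProductSpace ℂ H] [CompleteSpace H]
variable (π : M →⋆ₙₐ[ℂ] (H →L[ℂ] H))
variable {E : Type v} [NormedAddCommGroup E] [NormedSpace ℂ E] [CompleteSpace E]

/-- Cauchy–Schwarz, contractivity of the $*$-homomorphism $\pi$, and $\|\langle
x,x\rangle\|=\|x\|^2$. -/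
theorem norm_tmul_le [HilbertModule M E] (x : E) (h : H) : ‖tmul π x h‖ ≤ ‖h‖ * ‖x‖ := by
  refine le_of_sq_le_sq ?_ (by positivity)
  rw [norm_sq_eq_re_inner (𝕜 := ℂ), inner_tmul]
  calc RCLike.re ⟪h, π (ip M x x) h⟫_ℂ ≤ ‖h‖ * ‖π (ip M x x) h‖ := re_inner_le_norm _ _
    _ ≤ ‖h‖ * (‖ip M x x‖ * ‖h‖) := by
      gcongr
      refine ((π (ip M x x)).le_opNorm h).trans ?_
      gcongr
      exact NonUnitalStarAlgHom.norm_apply_le π _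
    _ = (‖h‖ * ‖x‖) ^ 2 := by
      rw [show ‖ip M x x‖ = ‖x‖ ^ 2 from (HilbertModule.norm_sq x).symm]; ring

/-- The bounded operator `x ↦ x ⊗ h` from `E` to `E ⊗_π H`. -/
noncomputable def tmulRight [HilbertModule M E] (h : H) : E →L[ℂ] HilbertTensor π E :=
  LinearMap.mkContinuous
    { toFun := fun x => tmul π x h
      map_add' := fun x y => by
        simp only [tmul, TensorProduct.add_tmul]
        exact UniformSpace.Completion.coe_add (toPre π (x ⊗ₜ[ℂ] h)) (toPre π (y ⊗ₜ[ℂ] h))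
      map_smul' := fun c x => by
        simp only [tmul, ← TensorProduct.smul_tmul']
        exact UniformSpace.Completion.coe_smul c (toPre π (x ⊗ₜ[ℂ] h)) }
    ‖h‖ (fun x => norm_tmul_le π x h)

@[simp] theorem tmulRight_apply [HilbertModule M E] (x : E) (h : H) :
    tmulRight π h x = tmul π x h := rfl

/-- Vectors of the algebraic tensor product are dense in its completion and are finite sums of
elementary tensors. -/
theorem topologicalClosure_span_tmul [HilbertModule M E] :
    (Submodule.span ℂ {z : HilbertTensor π E | ∃ x h, z = tmul π x h}).topologicalClosure = ⊤ := by
  refine Submodule.eq_top_iff'.2 fun z => ?_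
  induction z using UniformSpace.Completion.induction_on with
  | hp => exact Submodule.isClosed_topologicalClosure _
  | ih t =>
    obtain ⟨n, x, h, ht⟩ := exists_tmul_sum (t : E ⊗[ℂ] H)
    have e : ((t : PreTensor π E) : HilbertTensor π E) = ∑ i, tmul π (x i) (h i) := by
      have e1 : t = ∑ i, toPre π (x i ⊗ₜ[ℂ] h i) := ht
      rw [e1]
      exact map_sum (UniformSpace.Completion.toComplL (𝕜 := ℂ) (E := PreTensor π E)) _ _
    rw [e]
    exact Submodule.le_topologicalClosure _
      (Submodule.sum_mem _ fun i _ => Submodule.subset_span ⟨_, _, rfl⟩)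

/-- The functional `x ↦ ⟨z, x ⊗ h⟩` on `E`. -/
noncomputable def innerTmul [HilbertModule M E] (z : HilbertTensor π E) (h : H) : E →L[ℂ] ℂ :=
  innerSL ℂ z ∘L tmulRight π h

@[simp] theorem innerTmul_apply [HilbertModule M E] (z : HilbertTensor π E) (h : H) (x : E) :
    innerTmul π z h x = ⟪z, tmul π x h⟫_ℂ := rfl

/-- If `U : K → E` has an adjoint, then the functionals `x ↦ ⟨z, U x ⊗ h⟩` on `K` belong to the
predual of `K`. -/
theorem innerTmul_comp_mem_sigmaFunctionals [HilbertModule M E] {K : Type v}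
    [NormedAddCommGroup K] [NormedSpace ℂ K] [CompleteSpace K] [HilbertModule M K]
    (hπ : Setting.wstar.IsRepresentation π) (U : K →L[ℂ] E) (V : E → K)
    (hUV : ∀ z g, ip M (U z) g = ip M z (V g)) (z : HilbertTensor π E) (h : H) :
    innerTmul π z h ∘L U ∈ sigmaFunctionals M K := by
  -- The functional depends on $z$ norm-continuously and conjugate-linearly. As the predual is by
  -- definition norm closed, it suffices to treat elementary tensors $z$.
  let Φ : HilbertTensor π E →L⋆[ℂ] K →L[ℂ] ℂ :=
    LinearMap.mkContinuous
      { toFun := fun z => innerTmul π z h ∘L U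
        map_add' := fun x y => by ext k; simp [inner_add_left]
        map_smul' := fun c x => by ext k; simp [inner_smul_left] }
      (‖tmulRight (E := E) π h‖ * ‖U‖) (fun z => by
        refine ContinuousLinearMap.opNorm_le_bound _ (by positivity) fun k => ?_
        change ‖⟪z, tmulRight π h (U k)⟫_ℂ‖ ≤ _
        calc _ ≤ ‖z‖ * ‖tmulRight π h (U k)‖ := norm_inner_le_norm _ _
          _ ≤ ‖z‖ * (‖tmulRight (E := E) π h‖ * (‖U‖ * ‖k‖)) := by
            gcongr
            exact (ContinuousLinearMap.le_opNorm _ _).trans (by gcongr; exact U.le_opNorm k)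
          _ = _ := by ring)
  have hcl : IsClosed {z | Φ z ∈ sigmaFunctionals M K} :=
    (Submodule.isClosed_topologicalClosure _).preimage Φ.continuous
  have hspan : (Submodule.span ℂ {z : HilbertTensor π E | ∃ x h, z = tmul π x h} : Set _) ⊆
      {z | Φ z ∈ sigmaFunctionals M K} := by
    intro z hz
    induction hz using Submodule.span_induction with
    | mem z hz =>
      obtain ⟨y, g, rfl⟩ := hz
      obtain ⟨ω, hω, hωa⟩ := hπ g h
      -- Here $\langle y\otimes g,Ux\otimes h\rangle=\langle g,\pi(\langle
      -- y,Ux\rangle)h\rangle=\omega(\langle Vy,x\rangle)$, where the normal functional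
      -- $\omega=\langle g,\pi(\cdot)h\rangle$ comes from normality of $\pi$. This is a generator of
      -- the predual, with $\eta=Vy$.
      refine Submodule.le_topologicalClosure _ (Submodule.subset_span ⟨ω, hω, V y, fun x => ?_⟩)
      change ⟪tmul π y g, tmul π (U x) h⟫_ℂ = _
      rw [inner_tmul, hωa]
      congr 3
      rw [ip, ip, ← HilbertModule.star_ip (U x), ← HilbertModule.star_ip x]
      exact congrArg star (hUV x y)
    | zero =>
      change Φ 0 ∈ sigmaFunctionals M K
      rw [map_zero]; exact Submodule.zero_mem _
    | add x y _ _ hx hy =>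
      change Φ (x + y) ∈ sigmaFunctionals M K
      rw [map_add]; exact Submodule.add_mem _ hx hy
    | smul c x _ hx =>
      change Φ (c • x) ∈ sigmaFunctionals M K
      rw [map_smulₛₗ]; exact Submodule.smul_mem _ _ hx
  have : z ∈ (Submodule.span ℂ
      {z : HilbertTensor π E | ∃ x h, z = tmul π x h}).topologicalClosure := by
    rw [topologicalClosure_span_tmul]; trivial
  exact closure_minimal hspan hcl this

/-- A functional in the predual that vanishes on a `σ`-dense set is zero. -/
theorem eq_zero_of_mem_sigmaFunctionals [HilbertModule M E] {φ : E →L[ℂ] ℂ}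
    (hφ : φ ∈ sigmaFunctionals M E) {s : Set E} (hs : @Dense E (sigmaTopology M E) s)
    (h0 : ∀ x ∈ s, φ x = 0) (x : E) : φ x = 0 := by
  have hc : @Continuous E ℂ (sigmaTopology M E) _ (fun x => φ x) :=
    continuous_iff_le_induced.2 (iInf₂_le φ hφ)
  -- The $\sigma$-topology makes $\varphi$ continuous, so its zero set is $\sigma$-closed.
  have : @closure E (sigmaTopology M E) s ⊆ {x | φ x = 0} :=
    @closure_minimal E (sigmaTopology M E) s _ h0
      (@IsClosed.preimage E ℂ (sigmaTopology M E) _ _ hc _ isClosed_singleton)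
  exact this (hs x)

/-- If `u x y = U (x ⊗ y)` for a coisometry `U`, then the vectors `u x y ⊗ h` are total. -/
theorem Setting.IsCoisometric.eq_zero_of_inner_tmul {k : Setting} {F G : Type v}
    [Correspondence M E] [NormedAddCommGroup F] [NormedSpace ℂ F] [CompleteSpace F]
    [Correspondence M F] [NormedAddCommGroup G] [NormedSpace ℂ G] [CompleteSpace G]
    [Correspondence M G] {u : E →ₗ[ℂ] F →ₗ[ℂ] G} (hu : k.IsCoisometric M u)
    (hπ : k.IsRepresentation π) (z : HilbertTensor π G)
    (hz : ∀ x y h, ⟪z, tmul π (u x y) h⟫_ℂ = 0) : z = 0 := by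
  obtain ⟨K, _, _, _, _, τ, U, V, hτ, hU, -, -, hadj, hUV⟩ := hu
  have key : ∀ h g, innerTmul π z h g = 0 := by
    intro h g
    -- Writing $g=U(Vg)$ moves the question to the tensor product $K$, where density of elementary
    -- tensors is available; the functional composed with $U$ vanishes on their span.
    rw [← hUV g]
    have h0 : ∀ y ∈ Submodule.span ℂ {z : K | ∃ x y, z = τ x y},
        (innerTmul π z h ∘L U) y = 0 := by
      intro y hy
      induction hy using Submodule.span_induction with
      | mem y hy =>
        obtain ⟨a, b, rfl⟩ := hy
        change innerTmul π z h (U (τ a b)) = 0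
        rw [hU]; exact hz a b h
      | zero => exact map_zero _
      | add x y _ _ hx hy => rw [map_add, hx, hy, add_zero]
      | smul c x _ hx => rw [map_smul, hx, smul_zero]
    change (innerTmul π z h ∘L U) (V g) = 0
    have hd := hτ.dense
    cases k with
    | cstar =>
      exact closure_minimal (t := {y | (innerTmul π z h ∘L U) y = 0}) h0
        (isClosed_singleton.preimage (innerTmul π z h ∘L U).continuous) (hd (V g))
    | wstar =>
      exact eq_zero_of_mem_sigmaFunctionals
        (innerTmul_comp_mem_sigmaFunctionals π hπ U V hadj z h) hd h0 (V g)
  -- Orthogonality to all $g\otimes h$, hence to a dense subspace of $G\otimes_\pi H$, forces $z=0$.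
  have hz' : z ∈ (Submodule.span ℂ {z : HilbertTensor π G | ∃ x h, z = tmul π x h})ᗮ := by
    rw [Submodule.mem_orthogonal']
    intro y hy
    induction hy using Submodule.span_induction with
    | mem y hy => obtain ⟨a, b, rfl⟩ := hy; exact key b a
    | zero => exact inner_zero_right _
    | add x y _ _ hx hy => rw [inner_add_right, hx, hy, add_zero]
    | smul c x _ hx => rw [inner_smul_right, hx, mul_zero]
  rw [← Submodule.orthogonal_closure, topologicalClosure_span_tmul] at hz'
  simpa using hz'

end HilbertTensor

/-! ### Partial isometries -/

section PartialIsometry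

variable {K : Type w} {H : Type z} [NormedAddCommGroup K] [InnerProductSpace ℂ K]
  [NormedAddCommGroup H] [InnerProductSpace ℂ H]

theorem IsPartialIsometry.inner_map_map_of_mem {A : K →L[ℂ] H} (hA : IsPartialIsometry A) {x y : K}
    (hx : x ∈ (LinearMap.ker A.toLinearMap)ᗮ) (hy : y ∈ (LinearMap.ker A.toLinearMap)ᗮ) :
    ⟪A x, A y⟫_ℂ = ⟪x, y⟫_ℂ := by
  let B : (LinearMap.ker A.toLinearMap)ᗮ →ₗᵢ[ℂ] H :=
    { toLinearMap := A.toLinearMap ∘ₗ (LinearMap.ker A.toLinearMap)ᗮ.subtype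
      norm_map' := fun x => hA x x.2 }
  exact B.inner_map_map ⟨x, hx⟩ ⟨y, hy⟩

variable [CompleteSpace K]

/-- Orthogonal decomposition along the closed kernel. It provides each vector of the range with a
preimage on which a partial isometry is isometric. -/
theorem exists_mem_orthogonal_ker (A : K →L[ℂ] H) (y : K) :
    ∃ x ∈ (LinearMap.ker A.toLinearMap)ᗮ, A x = A y ∧
      y - x ∈ LinearMap.ker A.toLinearMap := by
  have hc : IsClosed (LinearMap.ker A.toLinearMap : Set K) := A.isClosed_ker
  have : CompleteSpace (LinearMap.ker A.toLinearMap) := hc.completeSpace_coe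
  obtain ⟨a, ha, b, hb, rfl⟩ :=
    (LinearMap.ker A.toLinearMap).exists_add_mem_mem_orthogonal y
  refine ⟨b, hb, ?_, by simpa using ha⟩
  have ha' : A a = 0 := ha
  rw [map_add, ha', zero_add]

/-- Only one argument need lie in $(\ker A)^\perp$: projecting $y$ there changes neither $Ay$ nor
the inner product with $x$. -/
theorem IsPartialIsometry.inner_map_map {A : K →L[ℂ] H} (hA : IsPartialIsometry A) {x : K}
    (hx : x ∈ (LinearMap.ker A.toLinearMap)ᗮ) (y : K) : ⟪A x, A y⟫_ℂ = ⟪x, y⟫_ℂ := by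
  obtain ⟨w, hw, hwy, hk⟩ := exists_mem_orthogonal_ker A y
  rw [← hwy, hA.inner_map_map_of_mem hx hw, ← sub_eq_zero, ← inner_sub_right]
  rw [Submodule.mem_orthogonal'] at hx
  rw [← neg_sub, inner_neg_right, hx _ hk, neg_zero]

/-- The range is already attained on the complete space $(\ker A)^\perp$, where $A$ is isometric. -/
theorem IsPartialIsometry.isClosed_range {A : K →L[ℂ] H} (hA : IsPartialIsometry A) :
    IsClosed (LinearMap.range A.toLinearMap : Set H) := by
  let B : (LinearMap.ker A.toLinearMap)ᗮ →ₗᵢ[ℂ] H :=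
    { toLinearMap := A.toLinearMap ∘ₗ (LinearMap.ker A.toLinearMap)ᗮ.subtype
      norm_map' := fun x => hA x x.2 }
  have e : (LinearMap.range A.toLinearMap : Set H) = Set.range B := by
    ext y
    constructor
    · rintro ⟨x, rfl⟩
      obtain ⟨w, hw, hwx, -⟩ := exists_mem_orthogonal_ker A x
      exact ⟨⟨w, hw⟩, hwx⟩
    · rintro ⟨x, rfl⟩
      exact ⟨x, rfl⟩
  rw [e]
  exact B.isometry.isClosedEmbedding.isClosed_range

end PartialIsometry

/-! ### The degree-zero summand and the creation operators -/

section Main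

variable {k : Setting} {M : Type u} [NonUnitalCStarAlgebra M] [PartialOrder M] [StarOrderedRing M]
  {X : ℕ → Type v} [∀ n, NormedAddCommGroup (X n)] [∀ n, NormedSpace ℂ (X n)]
  [∀ n, CompleteSpace (X n)] [∀ n, Correspondence M (X n)] (S : SubproductSystem k M X)
  {E : Type w} [NormedAddCommGroup E] [InnerProductSpace ℂ E] [CompleteSpace E]
  (π : M →⋆ₙₐ[ℂ] (E →L[ℂ] E))
  {H : Type z} [NormedAddCommGroup H] [InnerProductSpace ℂ H]

theorem SubproductSystem.creation_apply_of_lt {n l : ℕ} (h : l < n) (ζ : X n) (x : Fock π X) :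
    S.creation π n ζ x l = 0 :=
  dif_neg (not_le.2 h)

variable {π} in
theorem inner_eq_zero_of_mem_vacuum {x y : Fock π X} (hx : x ∈ vacuum π X) (hy : y 0 = 0) :
    ⟪x, y⟫_ℂ = 0 := by
  rw [lp.inner_eq_tsum, ← tsum_zero (α := ℂ) (β := ℕ)]
  congr 1
  ext n
  by_cases hn : n = 0
  · subst hn; rw [hy, inner_zero_right]
  · rw [hx n hn, inner_zero_left]

/-- `M ⊗_π E` is the orthogonal complement of the ranges of the operators `S_1(ζ) ⊗ I`. -/
theorem SubproductSystem.mem_vacuum_of_inner_creation {π : M →⋆ₙₐ[ℂ] (E →L[ℂ] E)}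
    (hπ : k.IsRepresentation π) {x : Fock π X}
    (hx : ∀ (ζ : X 1) y, ⟪x, S.creation π 1 ζ y⟫_ℂ = 0) : x ∈ vacuum π X := by
  intro n hn
  obtain ⟨m, rfl⟩ := Nat.exists_eq_succ_of_ne_zero hn
  -- The component in degree $m+1$ is tested against $U_{1,m}(\zeta\otimes\eta)\otimes e$, which is
  -- the image under $S_1(\zeta)\otimes I$ of $\eta\otimes e$ placed in degree $m$.
  refine (S.isCoisometric (Nat.add_comm 1 m)).eq_zero_of_inner_tmul π hπ _ fun ζ η e => ?_
  have := hx ζ (lp.single 2 m (tmul π η e))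
  rwa [S.creation_single π (Nat.add_comm 1 m), lp.inner_single_right] at this

/-! ### Wandering subspaces of the covariant representation -/

namespace CovariantRep

variable {S} (T : CovariantRep S H)

theorem mem_orthogonal_L {n : ℕ} {V : Submodule ℂ H} {w : H} :
    w ∈ (T.L n V)ᗮ ↔ ∀ ζ : X n, ∀ v ∈ V, ⟪w, T.T n ζ v⟫_ℂ = 0 := by
  rw [L, Submodule.orthogonal_closure, Submodule.mem_orthogonal']
  constructor
  · exact fun h ζ v hv => h _ (Submodule.subset_span ⟨ζ, v, hv, rfl⟩)
  · intro h y hy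
    induction hy using Submodule.span_induction with
    | mem y hy => obtain ⟨ζ, v, hv, rfl⟩ := hy; exact h ζ v hv
    | zero => exact inner_zero_right _
    | add x y _ _ hx hy => rw [inner_add_right, hx, hy, add_zero]
    | smul c x _ hx => rw [inner_smul_right, hx, mul_zero]

/-- The left action is multiplication by a degree-zero element, so multiplicativity applies. The
field `covariant` carries a right factor as well, and without a unit in $\mathcal M$ it cannot
simply be set to $1$. -/
theorem T_lmul {n : ℕ} (a : M) (ζ : X n) (v : H) :
    T.T n (lmul a ζ) v = T.T 0 (S.unit a) (T.T n ζ v) := by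
  rw [← S.unit_mul (Nat.zero_add n), T.map_mul]; rfl

theorem inner_T_unit (a : M) (x y : H) :
    ⟪T.T 0 (S.unit a) x, y⟫_ℂ = ⟪x, T.T 0 (S.unit (star a)) y⟫_ℂ := by
  rw [← T.map_star, star_star]

/-- $\langle\sigma(a)w,T_1(\zeta)v\rangle=\langle w,\sigma(a^*)T_1(\zeta)v\rangle=\langle
w,T_1(a^*\zeta)v\rangle=0$. -/
theorem unit_mem_wanderingPart {V : Submodule ℂ H} (hV : T.IsInvariant V) (a : M) {w : H}
    (hw : w ∈ T.wanderingPart V) : T.T 0 (S.unit a) w ∈ T.wanderingPart V := by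
  refine ⟨hV 0 _ w hw.1, T.mem_orthogonal_L.2 fun ζ v hv => ?_⟩
  rw [T.inner_T_unit, ← T.T_lmul]
  exact T.mem_orthogonal_L.1 hw.2 _ v hv

theorem isClosed_wanderingPart {V : Submodule ℂ H} (hV : IsClosed (V : Set H)) :
    IsClosed (T.wanderingPart V : Set H) :=
  hV.inter (Submodule.isClosed_orthogonal _)

variable {π} {T} {P : Fock π X →L[ℂ] H}

theorem inner_map_T (hP : IsPartialIsometry P)
    (hPT : ∀ (n : ℕ) (ζ : X n), P ∘L S.creation π n ζ = T.T n ζ ∘L P) {x : Fock π X}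
    (hx : x ∈ (LinearMap.ker P.toLinearMap)ᗮ) {n : ℕ} (ζ : X n) (y : Fock π X) :
    ⟪P x, T.T n ζ (P y)⟫_ℂ = ⟪x, S.creation π n ζ y⟫_ℂ := by
  rw [← hP.inner_map_map hx]
  exact congrArg (fun A => ⟪P x, A y⟫_ℂ) (hPT n ζ).symm

theorem isInvariant_range (hPT : ∀ (n : ℕ) (ζ : X n), P ∘L S.creation π n ζ = T.T n ζ ∘L P) :
    T.IsInvariant (LinearMap.range P.toLinearMap) := by
  rintro n ζ _ ⟨y, rfl⟩
  exact ⟨S.creation π n ζ y, congrArg (fun A => A y) (hPT n ζ)⟩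

/-- Creation by degree $n\ge1$ leaves nothing in degree zero. The case $n=1$ gives one inclusion of
the formula for $\mathcal W$; all $n$ together give the wandering property. -/
theorem inner_map_vacuum_T (hP : IsPartialIsometry P)
    (hPT : ∀ (n : ℕ) (ζ : X n), P ∘L S.creation π n ζ = T.T n ζ ∘L P) {w : H}
    (hw : w ∈ ((LinearMap.ker P.toLinearMap)ᗮ ⊓ vacuum π X).map P.toLinearMap) {n : ℕ}
    (hn : 1 ≤ n) (ζ : X n) {v : H} (hv : v ∈ LinearMap.range P.toLinearMap) :
    ⟪w, T.T n ζ v⟫_ℂ = 0 := by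
  obtain ⟨x, ⟨hx, hx0⟩, rfl⟩ := hw
  obtain ⟨y, rfl⟩ := hv
  exact (inner_map_T hP hPT hx ζ y).trans
    (inner_eq_zero_of_mem_vacuum hx0 (S.creation_apply_of_lt π hn ζ y))

theorem wanderingPart_range (hπ : k.IsRepresentation π) (hP : IsPartialIsometry P)
    (hPT : ∀ (n : ℕ) (ζ : X n), P ∘L S.creation π n ζ = T.T n ζ ∘L P) :
    T.wanderingPart (LinearMap.range P.toLinearMap) =
      ((LinearMap.ker P.toLinearMap)ᗮ ⊓ vacuum π X).map P.toLinearMap := by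
  ext w
  constructor
  · rintro ⟨⟨y, rfl⟩, hw⟩
    -- The given preimage $y$ need not lie in the degree-zero summand; its projection $x$ to
    -- $(\ker\Pi)^\perp$ does.
    obtain ⟨x, hx, hxy, -⟩ := exists_mem_orthogonal_ker P y
    refine ⟨x, ⟨hx, S.mem_vacuum_of_inner_creation hπ fun ζ v => ?_⟩, hxy⟩
    rw [← inner_map_T hP hPT hx, hxy]
    exact T.mem_orthogonal_L.1 hw ζ _ ⟨v, rfl⟩
  · intro hw
    refine ⟨?_, T.mem_orthogonal_L.2 fun ζ v hv => inner_map_vacuum_T hP hPT hw le_rfl ζ hv⟩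
    obtain ⟨x, -, rfl⟩ := hw
    exact ⟨x, rfl⟩

end CovariantRep

end Main

end Subproduct

open Subproduct in
theorem theorem5p3 (k : Setting)
    {M : Type u} [NonUnitalCStarAlgebra M] [PartialOrder M] [StarOrderedRing M]
    {X : ℕ → Type v} [∀ n, NormedAddCommGroup (X n)] [∀ n, NormedSpace ℂ (X n)]
    [∀ n, CompleteSpace (X n)] [∀ n, Correspondence M (X n)]
    (S : SubproductSystem k M X)
    {E : Type w} [NormedAddCommGroup E] [InnerProductSpace ℂ E] [CompleteSpace E]
    (π : M →⋆ₙₐ[ℂ] (E →L[ℂ] E)) (hπ : k.IsRepresentation π)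
    {H : Type z} [NormedAddCommGroup H] [InnerProductSpace ℂ H] [CompleteSpace H]
    (T : CovariantRep S H)
    (P : Fock π X →L[ℂ] H) (hP : IsPartialIsometry P)
    (hPT : ∀ (n : ℕ) (ζ : X n), P ∘L S.creation π n ζ = T.T n ζ ∘L P) :
    IsClosed (LinearMap.range P.toLinearMap : Set H) ∧
    (∃ hinv : T.IsInvariant (LinearMap.range P.toLinearMap),
      (T.restrict (LinearMap.range P.toLinearMap) hinv).IsWandering
        ((T.wanderingPart (LinearMap.range P.toLinearMap)).submoduleOf
          (LinearMap.range P.toLinearMap))) ∧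
    T.wanderingPart (LinearMap.range P.toLinearMap) =
      ((LinearMap.ker P.toLinearMap)ᗮ ⊓ vacuum π X).map P.toLinearMap := by
  have hclosed := hP.isClosed_range
  have hinv := CovariantRep.isInvariant_range hPT
  have hW := CovariantRep.wanderingPart_range hπ hP hPT
  refine ⟨hclosed, ⟨hinv, ?_, ?_, ?_⟩, hW⟩
  · exact (T.isClosed_wanderingPart hclosed).preimage continuous_subtype_val
  · exact fun a v hv => T.unit_mem_wanderingPart hinv a hv
  · intro n hn w hw
    -- Membership of $v$ in $\mathcal W$ is discarded: $\mathcal W$ is orthogonal to $T_n(\zeta)v$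
    -- for every $v\in\mathcal S$.
    refine (CovariantRep.mem_orthogonal_L _).2 fun ζ v _ => ?_
    have hw' : (w : H) ∈ T.wanderingPart (LinearMap.range P.toLinearMap) := hw
    rw [hW] at hw'
    exact CovariantRep.inner_map_vacuum_T hP hPT hw' hn ζ v.2
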